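/- All graphs are finite and undirected, without multiple edges but possibly with loops. The direct product $\Gamma\times\Sigma$ of graphs $\Gamma,\Sigma$ has vertex set $V(\Gamma)\times V(\Sigma)$, with $(u,i)$ adjacent to $(v,j)$ if and only if $u$ is adjacent to $v$ in $\Gamma$ and $i$ is adjacent to $j$ in $\Sigma$; the group $\mathrm{Aut}(\Gamma)\times\mathrm{Aut}(\Sigma)$ acts on it componentwise and so embeds in $\mathrm{Aut}(\Gamma\times\Sigma)$. The pair $(\Gamma,\Sigma)$ is unstable if $\mathrm{Aut}(\Gamma\times\Sigma)$ has an element outside $\mathrm{Aut}(\Gamma)\times\mathrm{Aut}(\Sigma)$. A graph is twin-free if no two distinct vertices have the same neighbourhood. Graphs $\Gamma$ and $\Sigma$ are coprime if there is no graph $\Delta$ with more than one vertex such that $\Gamma\cong\Gamma'\times\Delta$ and $\Sigma\cong\Sigma'\times\Delta$ for some graphs $\Gamma',\Sigma'$. The pair $(\Gamma,\Sigma)$ is nontrivial if $\Gamma$ and $\Sigma$ are coprime connected twin-free graphs and exactly one of them is bipartite, and it is nontrivially unstable if it is both nontrivial and unstable. **Theorem.** Let $n\ge 3$ be an odd integer,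 let $C_n$ be the cycle of length $n$, and let $\Gamma$ be a graph with at least one edge. Then the pair $(\Gamma,C_n)$ is not nontrivially unstable. -/

import Mathlib

/-- An undirected graph on the vertex set `V`, without multiple edges, possibly with loops. -/
@[ext]
structure LoopGraph (V : Type*) where
  Adj : V → V → Prop
  symm : ∀ u v, Adj u v → Adj v u

namespace LoopGraph

/-- The neighbourhood of a vertex (which contains the vertex itself iff there is a loop at it). -/
def neighborSet {V : Type*} (G : LoopGraph V) (v : V) : Set V := {w | G.Adj v w}

/-- Isomorphisms of graphs. -/
abbrev Iso {V W : Type*} (G : LoopGraph V) (H : LoopGraph W) : Type _ := G.Adj ≃r H.Adj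

/-- The automorphism group `Aut(G)`. -/
abbrev Aut {V : Type*} (G : LoopGraph V) : Type _ := G.Iso G

/-- The direct product of graphs. -/
def prod {V W : Type*} (G : LoopGraph V) (H : LoopGraph W) : LoopGraph (V × W) where
  Adj x y := G.Adj x.1 y.1 ∧ H.Adj x.2 y.2
  symm _ _ h := ⟨G.symm _ _ h.1, H.symm _ _ h.2⟩

/-- The natural embedding `Aut(G) × Aut(H) → Aut(G × H)`, acting componentwise. -/
def prodAut {V W : Type*} {G : LoopGraph V} {H : LoopGraph W} (α : G.Aut) (β : H.Aut) :
    (G.prod H).Aut where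
  toEquiv := α.toEquiv.prodCongr β.toEquiv
  map_rel_iff' := and_congr α.map_rel_iff β.map_rel_iff

/-- An automorphism of `G × H` is unexpected if it does not lie in `Aut(G) × Aut(H)`. -/
def IsUnexpected {V W : Type*} {G : LoopGraph V} {H : LoopGraph W} (τ : (G.prod H).Aut) : Prop :=
  ¬ ∃ (α : G.Aut) (β : H.Aut), τ = prodAut α β

/-- The pair `(G, H)` is unstable if `G × H` admits an unexpected automorphism. -/
def IsUnstablePair {V W : Type*} (G : LoopGraph V) (H : LoopGraph W) : Prop :=
  ∃ τ : (G.prod H).Aut, IsUnexpected τ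

/-- No two distinct vertices have the same neighbourhood. -/
def IsTwinFree {V : Type*} (G : LoopGraph V) : Prop :=
  ∀ u v : V, G.neighborSet u = G.neighborSet v → u = v

/-- A graph is connected if it is nonempty and any two vertices are joined by a walk. -/
def IsConnected {V : Type*} (G : LoopGraph V) : Prop :=
  Nonempty V ∧ ∀ u v : V, Relation.ReflTransGen G.Adj u v

/-- A graph is bipartite if its vertex set is the disjoint union of `U` and its complement such that
every edge has exactly one end in `U` (in particular there are no loops). -/
def IsBipartite {V : Type*} (G : LoopGraph V) : Prop :=
  ∃ U : Set V, ∀ u v : V, G.Adj u v → (u ∈ U ↔ v ∉ U)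

/-- Finite graphs `G` and `H` are coprime if there is no finite graph `Δ` of order greater than `1`
with `G ≅ G' × Δ` and `H ≅ H' × Δ` for some finite graphs `G'`, `H'`.  As all graphs are finite, it
is enough to let them range over graphs on the vertex sets `Fin k`. -/
def IsCoprime {V W : Type*} (G : LoopGraph V) (H : LoopGraph W) : Prop :=
  ¬ ∃ (d a b : ℕ) (Δ : LoopGraph (Fin d)) (G' : LoopGraph (Fin a)) (H' : LoopGraph (Fin b)),
    1 < d ∧ Nonempty (G.Iso (G'.prod Δ)) ∧ Nonempty (H.Iso (H'.prod Δ))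

/-- The pair `(G, H)` is nontrivial if `G` and `H` are coprime connected twin-free graphs and
exactly one of them is bipartite. -/
structure IsNontrivialPair {V W : Type*} (G : LoopGraph V) (H : LoopGraph W) : Prop where
  coprime : G.IsCoprime H
  connected_left : G.IsConnected
  connected_right : H.IsConnected
  twinFree_left : G.IsTwinFree
  twinFree_right : H.IsTwinFree
  bipartite : Xor G.IsBipartite H.IsBipartite

/-- The pair `(G, H)` is both nontrivial and unstable. -/
def IsNontriviallyUnstable {V W : Type*} (G : LoopGraph V) (H : LoopGraph W) : Prop :=
  G.IsNontrivialPair H ∧ G.IsUnstablePair H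

/-- A simple graph, regarded as a graph (without loops). -/
def ofSimpleGraph {V : Type*} (G : SimpleGraph V) : LoopGraph V where
  Adj := G.Adj
  symm _ _ h := h.symm

/-- The cycle `C_n` (meaningful for `n ≥ 3`). -/
def cycle (n : ℕ) : LoopGraph (Fin n) := ofSimpleGraph (SimpleGraph.cycleGraph n)

end LoopGraph

/-!
Write the vertices of `Γ × C_n` as pairs `(u, i)` with `i : ZMod n`, and let `σ` be the shift
`(u, i) ↦ (u, i + 2)`. For an automorphism `τ` of `Γ × C_n` consider the conjugate
`σ' = τ σ τ⁻¹`. A vertex `x` shares exactly half of its neighbours with `σ x`, hence also with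
`σ' x`, and `x`, `σ' x` have the same number of neighbours. As the common neighbours of two
vertices form a product set, and distinct vertices of an odd cycle have at most one common
neighbour, twin-freeness leaves two possibilities (`conj_two_dichotomy`): either `σ'` moves `x` to
`(u, i ± 2)` within its fibre `{u} × C_n`, or it preserves the cycle coordinate of `x`.

The first behaviour at one vertex spreads along its fibre (`conj_two_vertical_step`), and then to
the adjacent fibres (`conj_two_vertical_adj`). Since `Γ` is connected, either `σ' = σ` or
`σ' = σ⁻¹` or `σ'` preserves all cycle coordinates (`conj_two_global`).

* If `σ' = σ^{±1}`, then `τ` permutes the fibres and acts on them by a common isometry of `C_n`, so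
  it is a product of automorphisms (`not_isUnexpected_of_vertical`).
* Otherwise the same holds for `τ⁻¹`. As `n` is odd, `σ` generates all shifts, and their
  conjugates by `τ` have the form `(u, i) ↦ (g a u, i)` for a free action `g` of `ZMod n` on `Γ`,
  while the cycle coordinate of `τ⁻¹ (u, i)` depends on `u` only and is translated by `g`. This
  coordinate, together with the orbit of `u`, identifies `Γ` with a product `Γ' × C_n`
  (`exists_iso_prod_circ_of_horizontal`), so that `Γ` and `C_n` are not coprime.
-/

namespace LoopGraph

/-- The cycle of length `n` on the vertex set `ZMod n`. -/
def circ (n : ℕ) : LoopGraph (ZMod n) where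
  Adj i j := j = i + 1 ∨ j = i - 1
  symm := by
    rintro i j (rfl | rfl)
    · exact Or.inr (by ring)
    · exact Or.inl (by ring)

lemma cycle_eq_circ (m : ℕ) : cycle (m + 3) = circ (m + 3) := by
  apply LoopGraph.ext
  -- `Fin (m + 3)` and `ZMod (m + 3)` agree definitionally, arithmetic included
  have key : ∀ i j : ZMod (m + 3), (i - j = 1 ∨ j - i = 1) ↔ (j = i + 1 ∨ j = i - 1) := by
    intro i j
    rw [or_comm, sub_eq_iff_eq_add', sub_eq_iff_eq_add', eq_sub_iff_add_eq, eq_comm (a := i)]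
  funext i j
  exact propext (Iff.trans (SimpleGraph.cycleGraph_adj (n := m + 1)) (key i j))

/-! ### Arithmetic in `ZMod n` for odd `n` -/

lemma isUnit_two_zmod {n : ℕ} (hodd : Odd n) : IsUnit (2 : ZMod n) := by
  have := (ZMod.isUnit_iff_coprime 2 n).2 (Nat.coprime_two_left.2 hodd)
  simpa using this

lemma eq_zero_of_two_mul {n : ℕ} (hodd : Odd n) {a : ZMod n} (h : 2 * a = 0) : a = 0 :=
  (isUnit_two_zmod hodd).mul_right_eq_zero.1 h

lemma two_ne_zero_zmod {n : ℕ} (hn : 3 ≤ n) (hodd : Odd n) : (2 : ZMod n) ≠ 0 := by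
  have : Fact (1 < n) := ⟨by omega⟩
  exact (isUnit_two_zmod hodd).ne_zero

lemma two_add_two_ne_zero_zmod {n : ℕ} (hn : 3 ≤ n) (hodd : Odd n) : (2 + 2 : ZMod n) ≠ 0 :=
  fun h => two_ne_zero_zmod hn hodd (eq_zero_of_two_mul hodd (by linear_combination h))

lemma sign_mul_self {n : ℕ} {ε : ZMod n} (hε : ε = 1 ∨ ε = -1) : ε * ε = 1 := by
  rcases hε with rfl | rfl <;> ring

/-- Steps of length `2ε`, `ε = ±1`, reach every residue modulo an odd number. -/
lemma zmod_induction_two {n : ℕ} [NeZero n] (hodd : Odd n) {ε : ZMod n} (hε : ε = 1 ∨ ε = -1)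
    {P : ZMod n → Prop} {i : ZMod n} (hi : P i) (step : ∀ j, P j → P (j + 2 * ε)) (j : ZMod n) :
    P j := by
  obtain ⟨b, hb⟩ := (isUnit_two_zmod hodd).exists_right_inv
  have key : ∀ k : ℕ, P (i + k * (2 * ε)) := by
    intro k
    induction k with
    | zero => simpa using hi
    | succ k ih =>
      have := step _ ih
      rwa [show i + ((k + 1 : ℕ) : ZMod n) * (2 * ε) = i + k * (2 * ε) + 2 * ε by
        push_cast; ring]
  have hεε := sign_mul_self hε
  have h := key ((j - i) * b * ε).val
  rw [ZMod.natCast_zmod_val] at h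
  rwa [show i + (j - i) * b * ε * (2 * ε) = j by
    linear_combination (j - i) * (2 * b) * hεε + (j - i) * hb] at h

/-! ### Conjugated shifts -/

section

variable {V : Type*} {Γ : LoopGraph V} {n : ℕ}

/-- The automorphism `(u, i) ↦ (u, i + a)` of `Γ × C_n`. -/
def shift (Γ : LoopGraph V) (a : ZMod n) : (Γ.prod (circ n)).Aut where
  toEquiv := (Equiv.refl V).prodCongr (Equiv.addRight a)
  map_rel_iff' := by
    rintro ⟨u, i⟩ ⟨v, j⟩
    refine and_congr Iff.rfl ?_
    change (j + a = i + a + 1 ∨ j + a = i + a - 1) ↔ (j = i + 1 ∨ j = i - 1)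
    rw [add_right_comm, add_left_inj, add_sub_right_comm, add_left_inj]

/-- The conjugate by `τ` of the shift by `a`. -/
def conj (τ : (Γ.prod (circ n)).Aut) (a : ZMod n) : (Γ.prod (circ n)).Aut :=
  (τ.symm.trans (shift Γ a)).trans τ

lemma conj_apply (τ : (Γ.prod (circ n)).Aut) (a : ZMod n) (x : V × ZMod n) :
    conj τ a x = τ ((τ.symm x).1, (τ.symm x).2 + a) := rfl

lemma symm_conj (τ : (Γ.prod (circ n)).Aut) (a : ZMod n) (x : V × ZMod n) :
    τ.symm (conj τ a x) = ((τ.symm x).1, (τ.symm x).2 + a) := by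
  rw [conj_apply, RelIso.symm_apply_apply]

lemma conj_zero (τ : (Γ.prod (circ n)).Aut) (x : V × ZMod n) : conj τ 0 x = x := by
  rw [conj_apply, add_zero, RelIso.apply_symm_apply]

lemma conj_conj (τ : (Γ.prod (circ n)).Aut) (a b : ZMod n) (x : V × ZMod n) :
    conj τ a (conj τ b x) = conj τ (a + b) x := by
  rw [conj_apply, symm_conj, conj_apply]
  simp only [add_assoc, add_comm b a]

lemma conj_eq_self_iff (τ : (Γ.prod (circ n)).Aut) {a : ZMod n} {x : V × ZMod n} :
    conj τ a x = x ↔ a = 0 := by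
  refine ⟨fun h => ?_, fun h => by rw [h, conj_zero]⟩
  have h1 := symm_conj τ a x
  rw [h] at h1
  have h2 := congrArg Prod.snd h1
  simpa using h2

lemma adj_conj_iff (τ : (Γ.prod (circ n)).Aut) {a : ZMod n} {x y : V × ZMod n} :
    (Γ.prod (circ n)).Adj (conj τ a x) y ↔ (Γ.prod (circ n)).Adj x (conj τ (-a) y) := by
  rw [← (conj τ (-a)).map_rel_iff (a := conj τ a x), conj_conj, neg_add_cancel, conj_zero]

/-! ### Common neighbours -/

lemma neighborSet_inter_prod (x y : V × ZMod n) :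
    (Γ.prod (circ n)).neighborSet x ∩ (Γ.prod (circ n)).neighborSet y =
      (Γ.neighborSet x.1 ∩ Γ.neighborSet y.1) ×ˢ
        ((circ n).neighborSet x.2 ∩ (circ n).neighborSet y.2) := by
  ext z
  simp only [neighborSet, prod, Set.mem_inter_iff, Set.mem_ofPred_eq, Set.mem_prod]
  tauto

lemma image_neighborSet_inter (τ : (Γ.prod (circ n)).Aut) (x y : V × ZMod n) :
    τ '' ((Γ.prod (circ n)).neighborSet x ∩ (Γ.prod (circ n)).neighborSet y) =
      (Γ.prod (circ n)).neighborSet (τ x) ∩ (Γ.prod (circ n)).neighborSet (τ y) := by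
  ext z
  simp only [neighborSet, Set.mem_image, Set.mem_inter_iff, Set.mem_ofPred_eq]
  constructor
  · rintro ⟨w, hw, rfl⟩
    simpa only [τ.map_rel_iff] using hw
  · intro h
    refine ⟨τ.symm z, ?_, τ.apply_symm_apply z⟩
    rw [← τ.map_rel_iff, ← τ.map_rel_iff (a := y), τ.apply_symm_apply]
    exact h

lemma circ_neighborSet (i : ZMod n) : (circ n).neighborSet i = {i + 1, i - 1} := rfl

lemma circ_neighborSet_inter (hn : 3 ≤ n) (hodd : Odd n) (i : ZMod n) :
    (circ n).neighborSet i ∩ (circ n).neighborSet (i + 2) = {i + 1} := by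
  ext j
  simp only [circ_neighborSet, Set.mem_inter_iff, Set.mem_insert_iff, Set.mem_singleton_iff]
  constructor
  · rintro ⟨rfl | rfl, h⟩
    · rfl
    · exfalso
      rcases h with h | h
      · exact two_add_two_ne_zero_zmod hn hodd (by linear_combination -h)
      · exact two_ne_zero_zmod hn hodd (by linear_combination -h)
  · rintro rfl
    exact ⟨Or.inl rfl, Or.inr (by ring)⟩

lemma circ_neighborSet_ncard (hn : 3 ≤ n) (hodd : Odd n) (i : ZMod n) :
    ((circ n).neighborSet i).ncard = 2 := by
  rw [circ_neighborSet]
  exact Set.ncard_pair fun h => two_ne_zero_zmod hn hodd (by linear_combination h)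

/-- A vertex shares exactly half of its neighbours with its image under a conjugate of the
shift by `2`. -/
lemma two_mul_ncard_inter_conj (hn : 3 ≤ n) (hodd : Odd n) (τ : (Γ.prod (circ n)).Aut)
    (x : V × ZMod n) :
    2 * ((Γ.prod (circ n)).neighborSet x ∩
        (Γ.prod (circ n)).neighborSet (conj τ 2 x)).ncard =
      2 * (Γ.neighborSet x.1).ncard ∧
    2 * ((Γ.prod (circ n)).neighborSet x ∩
        (Γ.prod (circ n)).neighborSet (conj τ 2 x)).ncard =
      2 * (Γ.neighborSet (conj τ 2 x).1).ncard := by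
  have deg : ∀ z : V × ZMod n, ((Γ.prod (circ n)).neighborSet z ∩
      (Γ.prod (circ n)).neighborSet z).ncard = 2 * (Γ.neighborSet z.1).ncard := by
    intro z
    rw [neighborSet_inter_prod, Set.inter_self, Set.inter_self, Set.ncard_prod,
      circ_neighborSet_ncard hn hodd, mul_comm]
  have tr : ∀ y z : V × ZMod n, ((Γ.prod (circ n)).neighborSet (τ y) ∩
      (Γ.prod (circ n)).neighborSet (τ z)).ncard = ((Γ.prod (circ n)).neighborSet y ∩
      (Γ.prod (circ n)).neighborSet z).ncard := by
    intro y z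
    rw [← image_neighborSet_inter, Set.ncard_image_of_injective _ τ.injective]
  have half : ∀ z : V × ZMod n, ((Γ.prod (circ n)).neighborSet z ∩
      (Γ.prod (circ n)).neighborSet (z.1, z.2 + 2)).ncard = (Γ.neighborSet z.1).ncard := by
    intro z
    rw [neighborSet_inter_prod, Set.inter_self, circ_neighborSet_inter hn hodd, Set.ncard_prod,
      Set.ncard_singleton, mul_one]
  obtain ⟨z, rfl⟩ := τ.surjective x
  have hc : conj τ 2 (τ z) = τ (z.1, z.2 + 2) := by rw [conj_apply, τ.symm_apply_apply]
  rw [← deg, ← deg, hc, tr, tr, tr, half, deg, deg]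
  exact ⟨rfl, rfl⟩

/-- Conjugates of the shift by `2` either preserve the cycle coordinate or move the
vertex by `±2` inside its own fibre. -/
lemma conj_two_dichotomy [Finite V] (hn : 3 ≤ n) (hodd : Odd n) (htf : Γ.IsTwinFree)
    (hne : ∀ u, ∃ v, Γ.Adj u v) (τ : (Γ.prod (circ n)).Aut) (x : V × ZMod n) :
    (conj τ 2 x).2 = x.2 ∨
      ∃ ε : ZMod n, (ε = 1 ∨ ε = -1) ∧ conj τ 2 x = (x.1, x.2 + 2 * ε) := by
  obtain ⟨h1, h2⟩ := two_mul_ncard_inter_conj hn hodd τ x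
  generalize conj τ 2 x = y at *
  have hpos : ∀ u, 0 < (Γ.neighborSet u).ncard := fun u =>
    (Set.ncard_pos (Set.toFinite _)).2 (hne u)
  refine or_iff_not_imp_left.2 fun hxy => ?_
  -- `x` and `y` have a common neighbour, so their cycle coordinates differ by `0` or `±2`
  obtain ⟨ε, hε, he⟩ : ∃ ε : ZMod n, (ε = 1 ∨ ε = -1) ∧ y.2 = x.2 + 2 * ε := by
    have hpos' := hpos x.1
    have : ((Γ.prod (circ n)).neighborSet x ∩ (Γ.prod (circ n)).neighborSet y).Nonempty :=
      Set.nonempty_of_ncard_ne_zero (by omega)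
    obtain ⟨z, hz⟩ := this
    rw [neighborSet_inter_prod] at hz
    obtain ⟨-, hz1 | hz1, hz2 | hz2⟩ := hz
    · exact absurd (by linear_combination hz1 - hz2) hxy
    · exact ⟨1, Or.inl rfl, by linear_combination hz1 - hz2⟩
    · exact ⟨-1, Or.inr rfl, by linear_combination hz1 - hz2⟩
    · exact absurd (by linear_combination hz1 - hz2) hxy
  -- with a single common neighbour in the cycle, half the degree of `x` is attained only if the
  -- neighbourhoods of `x.1` and `y.1` coincide
  have hone : ((circ n).neighborSet x.2 ∩ (circ n).neighborSet y.2).ncard = 1 := by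
    rcases hε with rfl | rfl
    · rw [he, mul_one, circ_neighborSet_inter hn hodd, Set.ncard_singleton]
    · have : x.2 = y.2 + 2 := by rw [he]; ring
      rw [this, Set.inter_comm, circ_neighborSet_inter hn hodd, Set.ncard_singleton]
  rw [neighborSet_inter_prod, Set.ncard_prod, hone, mul_one] at h1 h2
  have e1 : Γ.neighborSet x.1 ∩ Γ.neighborSet y.1 = Γ.neighborSet x.1 :=
    Set.eq_of_subset_of_ncard_le Set.inter_subset_left (by omega) (Set.toFinite _)
  have e2 : Γ.neighborSet x.1 ∩ Γ.neighborSet y.1 = Γ.neighborSet y.1 :=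
    Set.eq_of_subset_of_ncard_le Set.inter_subset_right (by omega) (Set.toFinite _)
  exact ⟨ε, hε, Prod.ext (htf _ _ (e2.symm.trans e1)) he⟩

/-- If a conjugate of the shift by `2` moves one vertex inside its fibre, it acts in the same way
on the next vertex. -/
lemma conj_two_vertical_step [Finite V] (hn : 3 ≤ n) (hodd : Odd n) (htf : Γ.IsTwinFree)
    (hne : ∀ u, ∃ v, Γ.Adj u v) (τ : (Γ.prod (circ n)).Aut) {ε : ZMod n} (hε : ε = 1 ∨ ε = -1)
    {u : V} {i : ZMod n} (h : conj τ 2 (u, i) = (u, i + 2 * ε)) :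
    conj τ 2 (u, i + 2 * ε) = (u, i + 2 * ε + 2 * ε) := by
  have htwo := two_ne_zero_zmod hn hodd
  have hfour := two_add_two_ne_zero_zmod hn hodd
  have hεε := sign_mul_self hε
  have h2ε : 2 * ε ≠ 0 := fun h => htwo (by linear_combination ε * h - 2 * hεε)
  have hcc : conj τ 2 (u, i + 2 * ε) = conj τ (2 + 2) (u, i) := by rw [← h, conj_conj]
  rcases conj_two_dichotomy hn hodd htf hne τ (u, i + 2 * ε) with hh | ⟨δ, hδ, hv⟩
  · exfalso
    obtain ⟨⟨v, j⟩, y_def⟩ : ∃ y, conj τ 2 (u, i + 2 * ε) = y := ⟨_, rfl⟩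
    rw [y_def] at hh hcc
    obtain rfl : j = i + 2 * ε := hh
    -- `u` and `v` have a common neighbour
    obtain ⟨w, huw, hvw⟩ : (Γ.neighborSet u ∩ Γ.neighborSet v).Nonempty := by
      have h1 := (two_mul_ncard_inter_conj hn hodd τ (u, i + 2 * ε)).1
      have hp : 0 < (Γ.neighborSet u).ncard := (Set.ncard_pos (Set.toFinite _)).2 (hne u)
      have : ((Γ.prod (circ n)).neighborSet (u, i + 2 * ε) ∩
          (Γ.prod (circ n)).neighborSet (conj τ 2 (u, i + 2 * ε))).Nonempty :=
        Set.nonempty_of_ncard_ne_zero (by simp only at h1; omega)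
      rw [neighborSet_inter_prod, y_def] at this
      exact this.fst
    -- so `(u, i)` and its image under the conjugate of the shift by `4` have one, which forces
    -- `6 = 0`
    have a1 : (Γ.prod (circ n)).Adj (u, i) (w, i + ε) := by
      refine ⟨huw, ?_⟩
      rcases hε with rfl | rfl
      · exact Or.inl rfl
      · exact Or.inr (by ring)
    have a2 : (Γ.prod (circ n)).Adj (conj τ (2 + 2) (u, i)) (w, i + ε) := by
      rw [← hcc]
      refine ⟨hvw, ?_⟩
      rcases hε with rfl | rfl
      · exact Or.inr (by ring)
      · exact Or.inl (by ring)
    have hsix : (2 + 2 + 2 : ZMod n) = 0 := by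
      have b1 := (τ.symm.map_rel_iff.2 a1).2
      have b2 := (τ.symm.map_rel_iff.2 a2).2
      rw [symm_conj] at b2
      rcases b1 with b1 | b1 <;> rcases b2 with b2 | b2
      · exact absurd (by linear_combination b1 - b2) hfour
      · exact absurd (by linear_combination b1 - b2) htwo
      · linear_combination b1 - b2
      · exact absurd (by linear_combination b1 - b2) hfour
    -- the remaining case is that of the triangle, where applying the conjugate once more leads back
    have hback : conj τ 2 (v, i + 2 * ε) = (u, i) := by
      rw [hcc, conj_conj, conj_eq_self_iff]
      linear_combination hsix
    rcases conj_two_dichotomy hn hodd htf hne τ (v, i + 2 * ε) with hb | ⟨δ, hδ, hb⟩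
    · rw [hback] at hb
      exact h2ε (by linear_combination -hb)
    · rw [hback] at hb
      have huv : u = v := congrArg Prod.fst hb
      rw [← huv] at y_def
      exact htwo ((conj_eq_self_iff τ).1 y_def)
  · have : δ = ε := by
      by_contra hne'
      have hs : δ = -ε := by
        rcases hδ with rfl | rfl <;> rcases hε with rfl | rfl <;> simp_all
      rw [hs, hcc] at hv
      refine hfour ((conj_eq_self_iff τ (x := (u, i))).1 (hv.trans (Prod.ext rfl ?_)))
      change i + 2 * ε + 2 * -ε = i
      ring
    rw [hv, this]

lemma conj_two_vertical_fiber [Finite V] (hn : 3 ≤ n) (hodd : Odd n) (htf : Γ.IsTwinFree)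
    (hne : ∀ u, ∃ v, Γ.Adj u v) (τ : (Γ.prod (circ n)).Aut) {ε : ZMod n} (hε : ε = 1 ∨ ε = -1)
    {u : V} {i : ZMod n} (h : conj τ 2 (u, i) = (u, i + 2 * ε)) (j : ZMod n) :
    conj τ 2 (u, j) = (u, j + 2 * ε) :=
  have : NeZero n := ⟨by omega⟩
  zmod_induction_two hodd hε (P := fun j => conj τ 2 (u, j) = (u, j + 2 * ε)) h
    (fun _ => conj_two_vertical_step hn hodd htf hne τ hε) j

lemma conj_two_vertical_adj [Finite V] (hn : 3 ≤ n) (hodd : Odd n) (htf : Γ.IsTwinFree)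
    (hne : ∀ u, ∃ v, Γ.Adj u v) (τ : (Γ.prod (circ n)).Aut) {ε : ZMod n} (hε : ε = 1 ∨ ε = -1)
    {u w : V} (h : ∀ i, conj τ 2 (u, i) = (u, i + 2 * ε)) (huw : Γ.Adj u w) (j : ZMod n) :
    conj τ 2 (w, j) = (w, j + 2 * ε) := by
  have htwo := two_ne_zero_zmod hn hodd
  have hfour := two_add_two_ne_zero_zmod hn hodd
  have hεε := sign_mul_self hε
  -- the images of the two neighbours `(u, j ± 1)` of `(w, j)` determine the cycle coordinate
  have hc : (conj τ 2 (w, j)).2 = j + 2 * ε := by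
    have a1 : (Γ.prod (circ n)).Adj (u, j + 1) (w, j) := ⟨huw, Or.inr (by ring)⟩
    have a2 : (Γ.prod (circ n)).Adj (u, j - 1) (w, j) := ⟨huw, Or.inl (by ring)⟩
    rw [← (conj τ 2).map_rel_iff, h] at a1 a2
    rcases a1.2 with b1 | b1 <;> rcases a2.2 with b2 | b2 <;> simp only at b1 b2
    · linear_combination b2
    · exact absurd (by linear_combination b2 - b1) hfour
    · linear_combination b2
    · linear_combination b1
  rcases conj_two_dichotomy hn hodd htf hne τ (w, j) with hh | ⟨δ, -, hv⟩
  · rw [hc] at hh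
    exact absurd (by linear_combination ε * hh - 2 * hεε) htwo
  · exact Prod.ext (by rw [hv]) hc

/-- Globally, a conjugate of the shift by `2` is the shift by `2` or `-2`, or it preserves the
cycle coordinate. -/
lemma conj_two_global [Finite V] (hn : 3 ≤ n) (hodd : Odd n) (hconn : Γ.IsConnected)
    (htf : Γ.IsTwinFree) (hne : ∀ u, ∃ v, Γ.Adj u v) (τ : (Γ.prod (circ n)).Aut) :
    (∃ ε : ZMod n, (ε = 1 ∨ ε = -1) ∧ ∀ u i, conj τ 2 (u, i) = (u, i + 2 * ε)) ∨
      ∀ x, (conj τ 2 x).2 = x.2 := by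
  refine or_iff_not_imp_right.2 fun h => ?_
  obtain ⟨⟨u, i⟩, hx⟩ := not_forall.1 h
  obtain ⟨ε, hε, hv⟩ := (conj_two_dichotomy hn hodd htf hne τ (u, i)).resolve_left hx
  refine ⟨ε, hε, fun w => ?_⟩
  induction hconn.2 u w with
  | refl => exact conj_two_vertical_fiber hn hodd htf hne τ hε hv
  | tail _ hab ih => exact conj_two_vertical_adj hn hodd htf hne τ hε ih hab

/-! ### Automorphisms normalising the shifts -/

/-- An automorphism that conjugates the shift by `2` to the shift by `±2` is linear with slope `±1`
in the cycle coordinate; adjacent fibres get the same offset, so it is a product. -/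
lemma not_isUnexpected_of_vertical (hn : 3 ≤ n) (hodd : Odd n) (hconn : Γ.IsConnected)
    (τ : (Γ.prod (circ n)).Aut) {ε : ZMod n} (hε : ε = 1 ∨ ε = -1)
    (h : ∀ u i, conj τ 2 (u, i) = (u, i + 2 * ε)) : ¬ IsUnexpected τ := by
  have : NeZero n := ⟨by omega⟩
  have htwo := two_ne_zero_zmod hn hodd
  have hεε := sign_mul_self hε
  have step : ∀ u i, τ (u, i + 2) = ((τ (u, i)).1, (τ (u, i)).2 + 2 * ε) := by
    intro u i
    rw [← h, conj_apply]
    simp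
  have form : ∀ u i, τ (u, i) = ((τ (u, 0)).1, (τ (u, 0)).2 + ε * i) := by
    intro u i
    refine zmod_induction_two hodd (Or.inl rfl) (i := 0)
      (P := fun i => τ (u, i) = ((τ (u, 0)).1, (τ (u, 0)).2 + ε * i)) (by simp) ?_ i
    intro j hj
    rw [mul_one, step, hj]
    exact Prod.ext rfl (by ring)
  have hadj : ∀ u w, Γ.Adj u w → (τ (w, 0)).2 = (τ (u, 0)).2 := by
    intro u w huw
    have a1 : (Γ.prod (circ n)).Adj (u, 0) (w, ε) :=
      ⟨huw, by rcases hε with rfl | rfl <;> simp [circ]⟩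
    have a2 : (Γ.prod (circ n)).Adj (u, 0) (w, -ε) :=
      ⟨huw, by rcases hε with rfl | rfl <;> simp [circ]⟩
    rw [← τ.map_rel_iff, form w] at a1 a2
    rcases a1.2 with b1 | b1 <;> rcases a2.2 with b2 | b2 <;> simp only at b1 b2
    · exact absurd (by linear_combination b1 - b2 - 2 * hεε) htwo
    · exact eq_of_sub_eq_zero (eq_zero_of_two_mul hodd (by linear_combination b1 + b2))
    · exact eq_of_sub_eq_zero (eq_zero_of_two_mul hodd (by linear_combination b1 + b2))
    · exact absurd (by linear_combination b1 - b2 - 2 * hεε) htwo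
  obtain ⟨o⟩ := hconn.1
  have hconst : ∀ u, (τ (u, 0)).2 = (τ (o, 0)).2 := by
    intro u
    induction hconn.2 o u with
    | refl => rfl
    | tail _ hab ih => exact (hadj _ _ hab).trans ih
  have form' : ∀ u i, τ (u, i) = ((τ (u, 0)).1, (τ (o, 0)).2 + ε * i) := by
    intro u i
    rw [form, hconst]
  have hbij : Function.Bijective fun u => (τ (u, 0)).1 := by
    constructor
    · intro u w huw
      have : τ (u, 0) = τ (w, 0) := Prod.ext huw ((hconst u).trans (hconst w).symm)
      exact congrArg Prod.fst (τ.injective this)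
    · intro v
      obtain ⟨⟨u, i⟩, hu⟩ := τ.surjective (v, (τ (o, 0)).2)
      rw [form'] at hu
      exact ⟨u, congrArg Prod.fst hu⟩
  let β : ZMod n ≃ ZMod n :=
    { toFun := fun i => (τ (o, 0)).2 + ε * i
      invFun := fun j => ε * (j - (τ (o, 0)).2)
      left_inv := fun i => by linear_combination i * hεε
      right_inv := fun j => by linear_combination (j - (τ (o, 0)).2) * hεε }
  have hβ : ∀ i j, (circ n).Adj (β i) (β j) ↔ (circ n).Adj i j := by
    intro i j
    change (_ + ε * j = _ + ε * i + 1 ∨ _ + ε * j = _ + ε * i - 1) ↔ (j = i + 1 ∨ j = i - 1)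
    rcases hε with rfl | rfl
    · refine or_congr ⟨fun h => ?_, fun h => ?_⟩ ⟨fun h => ?_, fun h => ?_⟩ <;>
        linear_combination h
    · rw [or_comm]
      refine or_congr ⟨fun h => ?_, fun h => ?_⟩ ⟨fun h => ?_, fun h => ?_⟩ <;>
        linear_combination -h
  refine not_not_intro ⟨⟨Equiv.ofBijective _ hbij, ?_⟩, ⟨β, fun {i j} => hβ i j⟩, ?_⟩
  · intro u w
    have a1 := τ.map_rel_iff (a := (u, 0)) (b := (w, 1))
    rw [form' u, form' w] at a1
    have e1 : (circ n).Adj (0 : ZMod n) 1 := Or.inl (by ring)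
    have e2 := (hβ 0 1).2 e1
    exact ⟨fun h => (a1.1 ⟨h, e2⟩).1, fun h => (a1.2 ⟨h, e1⟩).1⟩
  · ext1 ⟨u, i⟩
    exact form' u i

/-! ### Automorphisms moving the fibres -/

/-- A free action `g` of `ZMod n` on `V`, together with a coordinate `φ` that it translates, splits
off a factor `C_n` as soon as adjacency is the conjunction of a `g`-invariant relation and
adjacency of the coordinates. -/
lemma exists_iso_prod_circ [Finite V] (g : ZMod n → V → V) (g_zero : ∀ u, g 0 u = u)
    (g_add : ∀ a b u, g a (g b u) = g (a + b) u) (φ : V → ZMod n)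
    (φ_g : ∀ a u, φ (g a u) = φ u + a) (Q : V → V → Prop)
    (Q_g : ∀ a b u w, Q (g a u) (g b w) ↔ Q u w)
    (hadj : ∀ u w, Γ.Adj u w ↔ Q u w ∧ (circ n).Adj (φ u) (φ w)) :
    ∃ (k : ℕ) (Γ' : LoopGraph (Fin k)), Nonempty (Γ.Iso (Γ'.prod (circ n))) := by
  obtain ⟨k, ⟨e⟩⟩ := Finite.exists_equiv_fin {u // φ u = 0}
  let Γ' : LoopGraph (Fin k) :=
    { Adj := fun s t => ∃ a b, Γ.Adj (g a (e.symm s)) (g b (e.symm t))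
      symm := fun s t ⟨a, b, h⟩ => ⟨b, a, Γ.symm _ _ h⟩ }
  refine ⟨k, Γ', ⟨⟨⟨fun u => (e ⟨g (-φ u) u, by rw [φ_g, add_neg_cancel]⟩, φ u),
    fun x => g x.2 (e.symm x.1), ?_, ?_⟩, ?_⟩⟩⟩
  · intro u
    simp [g_add, g_zero]
  · rintro ⟨s, i⟩
    obtain ⟨⟨w, hw⟩, rfl⟩ := e.surjective s
    simp [φ_g, hw, g_add, g_zero]
  · intro u w
    simp only [Equiv.coe_fn_mk, prod, Γ', Equiv.symm_apply_apply]
    rw [hadj]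
    refine and_congr_left fun h => ⟨?_, fun hQ => ?_⟩
    · rintro ⟨a, b, hab⟩
      rw [hadj, Q_g, Q_g] at hab
      exact hab.1
    · refine ⟨φ u, φ w, ?_⟩
      rw [g_add, g_add, add_neg_cancel, add_neg_cancel, g_zero, g_zero, hadj]
      exact ⟨hQ, h⟩

/-- If the conjugates of the shift by `2` by `τ` and by `τ⁻¹` preserve the cycle coordinate, then
`C_n` is a factor of `Γ`. -/
lemma exists_iso_prod_circ_of_horizontal [Finite V] (hn : 3 ≤ n) (hodd : Odd n)
    (htf : Γ.IsTwinFree) (τ : (Γ.prod (circ n)).Aut) (h : ∀ x, (conj τ 2 x).2 = x.2)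
    (h' : ∀ x, (conj τ.symm 2 x).2 = x.2) :
    ∃ (k : ℕ) (Γ' : LoopGraph (Fin k)), Nonempty (Γ.Iso (Γ'.prod (circ n))) := by
  have : NeZero n := ⟨by omega⟩
  have snd_conj : ∀ a x, (conj τ a x).2 = x.2 := by
    intro a
    refine zmod_induction_two hodd (Or.inl rfl) (i := 0)
      (P := fun a => ∀ x, (conj τ a x).2 = x.2) (fun x => by rw [conj_zero]) ?_ a
    intro b hb x
    rw [mul_one, ← conj_conj, hb, h]
  have adj_up : ∀ u w i, Γ.Adj u w ↔ (Γ.prod (circ n)).Adj (u, i) (w, i + 1) :=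
    fun u w i => ⟨fun h => ⟨h, Or.inl rfl⟩, fun h => h.1⟩
  have adj_down : ∀ u w i, Γ.Adj u w ↔ (Γ.prod (circ n)).Adj (u, i + 2) (w, i + 1) :=
    fun u w i => ⟨fun h => ⟨h, Or.inr (by ring)⟩, fun h => h.1⟩
  have conj_eq : ∀ a u i, conj τ a (u, i) = ((conj τ a (u, i)).1, i) :=
    fun a u i => Prod.ext rfl (snd_conj a _)
  -- compare the neighbours of `(u, i)` and `(u, i + 2)` at the level `i + 1`
  have fst_conj_step : ∀ a u i, (conj τ a (u, i + 2)).1 = (conj τ a (u, i)).1 := by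
    intro a u i
    refine htf _ _ (Set.ext fun w => ?_)
    change Γ.Adj _ w ↔ Γ.Adj _ w
    rw [adj_down _ w i, adj_up _ w i, ← conj_eq, ← conj_eq, adj_conj_iff, adj_conj_iff,
      conj_eq (-a), ← adj_down, ← adj_up]
  have fst_conj : ∀ a u i, (conj τ a (u, i)).1 = (conj τ a (u, 0)).1 := by
    intro a u i
    refine zmod_induction_two hodd (Or.inl rfl) (i := 0)
      (P := fun i => (conj τ a (u, i)).1 = (conj τ a (u, 0)).1) rfl ?_ i
    intro j hj
    rw [mul_one, fst_conj_step, hj]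
  have snd_symm : ∀ u i, (τ.symm (u, i)).2 = (τ.symm (u, 0)).2 := by
    intro u i
    refine zmod_induction_two hodd (Or.inl rfl) (i := 0)
      (P := fun i => (τ.symm (u, i)).2 = (τ.symm (u, 0)).2) rfl ?_ i
    intro j hj
    rw [← hj, mul_one]
    have := h' (τ.symm (u, j))
    rwa [conj_apply, RelIso.symm_symm, RelIso.apply_symm_apply] at this
  have g_eq : ∀ a u i, ((conj τ a (u, 0)).1, i) = conj τ a (u, i) := by
    intro a u i
    rw [conj_eq a u i, fst_conj a u i]
  refine exists_iso_prod_circ (fun a u => (conj τ a (u, 0)).1) (fun u => by rw [conj_zero]) ?_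
    (fun u => (τ.symm (u, 0)).2) ?_ (fun u w => Γ.Adj (τ.symm (u, 0)).1 (τ.symm (w, 1)).1) ?_ ?_
  · intro a b u
    rw [g_eq, conj_conj]
  · intro a u
    rw [g_eq, symm_conj]
  · intro a b u w
    rw [g_eq, g_eq, symm_conj, symm_conj]
  · intro u w
    rw [adj_up u w 0, ← τ.symm.map_rel_iff, zero_add, ← snd_symm w 1]
    rfl

/-- If the connected twin-free graph `Γ` has no isolated vertices and no factor `C_n`, then
`Γ × C_n` has no unexpected automorphisms. -/
theorem not_isUnexpected [Finite V] (hn : 3 ≤ n) (hodd : Odd n) (hconn : Γ.IsConnected)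
    (htf : Γ.IsTwinFree) (hne : ∀ u, ∃ v, Γ.Adj u v)
    (hfac : ¬ ∃ (k : ℕ) (Γ' : LoopGraph (Fin k)), Nonempty (Γ.Iso (Γ'.prod (circ n))))
    (τ : (Γ.prod (circ n)).Aut) : ¬ IsUnexpected τ := by
  rcases conj_two_global hn hodd hconn htf hne τ with ⟨ε, hε, h⟩ | h
  · exact not_isUnexpected_of_vertical hn hodd hconn τ hε h
  rcases conj_two_global hn hodd hconn htf hne τ.symm with ⟨ε, hε, h'⟩ | h'
  · exfalso
    have htwo := two_ne_zero_zmod hn hodd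
    obtain ⟨o⟩ := hconn.1
    -- `τ` conjugates the shift by `2ε` to the shift by `2`
    have key : ∀ x : V × ZMod n, conj τ (2 * ε) x = (x.1, x.2 + 2) := by
      intro x
      rw [conj_apply, ← h', Prod.mk.eta, conj_apply, RelIso.symm_symm, RelIso.apply_symm_apply,
        RelIso.apply_symm_apply]
    have hsnd : (conj τ (2 * ε) (o, 0)).2 = 0 := by
      rcases hε with rfl | rfl
      · rw [mul_one, h]
      · rw [← h, conj_conj]
        simp [conj_zero]
    rw [key] at hsnd
    exact htwo (by simpa using hsnd)
  · exact absurd (exists_iso_prod_circ_of_horizontal hn hodd htf τ h h') hfac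

end

end LoopGraph

theorem theorem1p5 {V : Type*} [Finite V] (Γ : LoopGraph V) (hΓ : ∃ u v : V, Γ.Adj u v)
    (n : ℕ) (hn : 3 ≤ n) (hodd : Odd n) :
    ¬ Γ.IsNontriviallyUnstable (LoopGraph.cycle n) := by
  rintro ⟨hnt, τ, hτ⟩
  obtain ⟨m, rfl⟩ : ∃ m, n = m + 3 := ⟨n - 3, by omega⟩
  have hne : ∀ u, ∃ v, Γ.Adj u v := by
    intro u
    obtain ⟨a, b, hab⟩ := hΓ
    rcases Relation.ReflTransGen.cases_head (hnt.connected_left.2 u a) with rfl | ⟨v, hv, -⟩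
    · exact ⟨b, hab⟩
    · exact ⟨v, hv⟩
  have hfac : ¬ ∃ (k : ℕ) (Γ' : LoopGraph (Fin k)),
      Nonempty (Γ.Iso (Γ'.prod (LoopGraph.cycle (m + 3)))) := by
    rintro ⟨k, Γ', hiso⟩
    -- a single vertex with a loop is the unit of the direct product
    let I : LoopGraph (Fin 1) := ⟨fun _ _ => True, fun _ _ _ => trivial⟩
    refine hnt.coprime ⟨m + 3, k, 1, LoopGraph.cycle (m + 3), Γ', I, by omega, hiso,
      ⟨⟨(Equiv.uniqueProd _ _).symm, ?_⟩⟩⟩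
    intro i j
    exact ⟨fun h => h.2, fun h => ⟨trivial, h⟩⟩
  rw [LoopGraph.cycle_eq_circ] at hfac
  revert τ
  rw [LoopGraph.cycle_eq_circ]
  exact fun τ hτ => LoopGraph.not_isUnexpected hn hodd hnt.connected_left hnt.twinFree_left hne
    hfac τ hτ
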